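/- Let $n\ge 1$, $k\ge 0$, let $A,Q\in\mathbb{R}^{n\times n}$ and $B\in\mathbb{R}^{n\times k}$ be constant matrices with $Q=Q^*$, and consider the linear quadratic optimal control problem $\dot x=Ax+Bu$ with cost $\tfrac12\int(u^*u-x^*Qx)\,dt$. Assume that it is controllable, i.e. $\operatorname{rank}(B,AB,\dots,A^{m-1}B)=n$ for some $m>0$. Its Hamiltonian on $\mathbb{R}^{2n}=\{(p,x)\}$ is $$H(z)=\tfrac12 z^*\mathbf{H}z,\qquad \mathbf{H}=\begin{pmatrix}BB^*&A\\A^*&Q\end{pmatrix}.$$ Put $\Omega=\begin{pmatrix}0&\mathbb{I}_n\\-\mathbb{I}_n&0\end{pmatrix}$, $\mathcal{V}=\{(p,0):p\in\mathbb{R}^n\}$, and let $J(t)=e^{t\Omega\mathbf{H}}\mathcal{V}$, $t\in\mathbb{R}$, be the Jacobi curve. A time $t$ is a conjugate time if $J(t)\cap\mathcal{V}\ne 0$, and its multiplicity is $\dim(J(t)\cap\mathcal{V})$. Suppose that in suitable linear symplectic coordinates the Hamiltonian takes the form $\tfrac12\sum_{j=1}^n\omega_j(p_j^2+x_j^2)$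 with $\omega_1,\dots,\omega_n\in\mathbb{R}$, i.e. there is a matrix $M$ with $M^*\Omega M=\Omega$ and $H(M(p,x))=\tfrac12\sum_{j=1}^n\omega_j(p_j^2+x_j^2)$ for all $(p,x)\in\mathbb{R}^{2n}$ (the coordinate change $M$ need not preserve $\mathcal{V}$). Then $\sum_{j=1}^n\omega_j>0$, and for all integers $N\ge 0$ and all real $$T\ \ge\ \frac{(N+3n-1)\pi}{\sum_{j=1}^n\omega_j}$$ there are at least $N$ conjugate times, counted with multiplicity, in the interval $(0,T]$. In particular, positive conjugate times exist, and the first conjugate time $\bar t=\inf\{t>0: J(t)\cap\mathcal{V}\neq 0\}$ satisfies $$\bar t\ \le\ \frac{3n\pi}{\sum_{j=1}^n\omega_j}.$$ -/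

import Mathlib

noncomputable section

/-- The data of a linear quadratic optimal control problem with state space `ℝⁿ` and control
space `ℝᵏ`: dynamics `ẋ = A x + B u`, cost `½ ∫ (u* u - x* Q x) dt`. -/
structure LQProblem (n k : ℕ) where
  /-- the drift -/
  A : Matrix (Fin n) (Fin n) ℝ
  /-- the control matrix -/
  B : Matrix (Fin n) (Fin k) ℝ
  /-- the potential -/
  Q : Matrix (Fin n) (Fin n) ℝ
  /-- the potential is a quadratic form, represented by a symmetric matrix -/
  Q_symm : Q.IsSymm

/-- The phase space `T^*ℝⁿ = ℝ²ⁿ`, whose elements are pairs `(p, x)`: the `Sum.inl` coordinates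
are `p`, the `Sum.inr` coordinates are `x`. -/
abbrev PhaseSpace (n : ℕ) : Type := Fin n ⊕ Fin n → ℝ

/-- The matrix `Ω = (0, I; -I, 0)` of the symplectic form `∑ dpᵢ ∧ dxᵢ`. -/
def symplecticForm (n : ℕ) : Matrix (Fin n ⊕ Fin n) (Fin n ⊕ Fin n) ℝ :=
  Matrix.fromBlocks 0 1 (-1) 0

/-- A linear change of coordinates of the phase space is symplectic if it preserves `Ω`. -/
def IsSymplectic {n : ℕ} (M : Matrix (Fin n ⊕ Fin n) (Fin n ⊕ Fin n) ℝ) : Prop :=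
  M.transpose * symplecticForm n * M = symplecticForm n

/-- The vertical subspace `{(p, 0)}`. -/
def verticalSpace (n : ℕ) : Submodule ℝ (PhaseSpace n) where
  carrier := {z | ∀ i, z (Sum.inr i) = 0}
  add_mem' := by
    intro a b ha hb i
    simp [ha i, hb i]
  zero_mem' := by
    intro i
    rfl
  smul_mem' := by
    intro c a ha i
    simp [ha i]

namespace LQProblem

variable {n k : ℕ}

/-- The block matrix `(B, A B, …, A^(m-1) B)`. -/
def kalmanMatrix (L : LQProblem n k) (m : ℕ) : Matrix (Fin n) (Fin m × Fin k) ℝ :=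
  Matrix.of fun i c => (L.A ^ (c.1 : ℕ) * L.B) i c.2

/-- Controllability: `rank (B, A B, …, A^(m-1) B) = n` for some `m > 0`. -/
def IsControllable (L : LQProblem n k) : Prop :=
  ∃ m : ℕ, 0 < m ∧ (L.kalmanMatrix m).rank = n

/-- The symmetric matrix `(B B*, A; A*, Q)` of the Hamiltonian. -/
def hamiltonianMatrix (L : LQProblem n k) : Matrix (Fin n ⊕ Fin n) (Fin n ⊕ Fin n) ℝ :=
  Matrix.fromBlocks (L.B * L.B.transpose) L.A L.A.transpose L.Q

/-- The Hamiltonian, a quadratic function of `z = (p, x)`. -/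
def hamiltonian (L : LQProblem n k) (z : PhaseSpace n) : ℝ :=
  (1 / 2) * (z ⬝ᵥ (L.hamiltonianMatrix.mulVec z))

/-- The Hamiltonian can be written as `½ ∑ ωⱼ (pⱼ² + xⱼ²)`, that is, it takes this form after a
linear symplectic change of coordinates (which need not preserve the vertical subspace). -/
def HasNormalForm (L : LQProblem n k) (ω : Fin n → ℝ) : Prop :=
  ∃ M : Matrix (Fin n ⊕ Fin n) (Fin n ⊕ Fin n) ℝ, IsSymplectic M ∧
    ∀ z : PhaseSpace n, L.hamiltonian (M.mulVec z) =
      (1 / 2) * ∑ j, ω j * (z (Sum.inl j) ^ 2 + z (Sum.inr j) ^ 2)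

/-- The Jacobi curve: the image of the vertical subspace under the matrix exponential
`exp (t Ω ℋ)`, where `ℋ` is the matrix of the Hamiltonian. -/
def jacobiCurve (L : LQProblem n k) (t : ℝ) : Submodule ℝ (PhaseSpace n) :=
  (verticalSpace n).map
    (NormedSpace.exp (t • (symplecticForm n * L.hamiltonianMatrix))).mulVecLin

/-- `t` is a conjugate time if the Jacobi curve at `t` meets the vertical subspace
nontrivially. -/
def IsConjugateTime (L : LQProblem n k) (t : ℝ) : Prop :=
  L.jacobiCurve t ⊓ verticalSpace n ≠ ⊥

/-- The multiplicity of a conjugate time (it is zero if `t` is not a conjugate time). -/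
def multiplicity (L : LQProblem n k) (t : ℝ) : ℕ :=
  Module.finrank ℝ ↥(L.jacobiCurve t ⊓ verticalSpace n)

/-- The number, possibly infinite, of conjugate times in `(0, T]`, counted with multiplicity:
the sum of the multiplicities, as the supremum of all its finite partial sums. -/
def conjugateCount (L : LQProblem n k) (T : ℝ) : ℕ∞ :=
  ⨆ (s : Finset ℝ) (_ : ∀ t ∈ s, 0 < t ∧ t ≤ T ∧ L.IsConjugateTime t),
    ((∑ t ∈ s, L.multiplicity t : ℕ) : ℕ∞)

/-- The set of positive conjugate times. -/
def positiveConjugateTimes (L : LQProblem n k) : Set ℝ :=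
  {t | 0 < t ∧ L.IsConjugateTime t}

/-- The first conjugate time: the infimum of the positive conjugate times (meaningful when there
are such times). -/
def firstConjugateTime (L : LQProblem n k) : ℝ :=
  sInf L.positiveConjugateTimes

end LQProblem

end

/-!
Let `Λ = M⁻¹ 𝒱` be the vertical subspace in the normal coordinates, and identify `(p, x)` with
`p + i x ∈ ℂⁿ`. The flow becomes `D(t) = diag (exp (-i t ωⱼ))`, so the multiplicity of `t` is the
dimension of `D(t) Λ ∩ Λ`. The Lagrangian subspace `Λ` has a frame `Z = a + i b` with
`aᵀ b = bᵀ a` (`LQProblem.HasNormalForm.exists_frame`).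

*Positivity.* The trace of the quadratic form `∑ ωⱼ |zⱼ|²` on `Λ` is `∑ ωⱼ`, because an orthonormal
basis of `Λ` is a unitary basis of `ℂⁿ` (`Matrix.sum_eq_trace_gram_inv`). On `𝒱` this form is
`|B* p|²`, which is nonnegative, and nonzero since controllability excludes `B = 0`.

*Counting.* With the unitary matrix `W = Z Z̄⁻¹`, the dimension of `D(t) Λ ∩ Λ` is the multiplicity
of the eigenvalue `1` of the unitary matrix `S(t) = D(t) W* D(t) W` (`Matrix.exists_souriau`).
Since `det S(t) = exp (-2 i t ∑ ωⱼ)`, the eigenvalues turn by a total angle `2T ∑ ωⱼ` during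
`[0, T]`, and `n` of them cannot absorb this rotation without passing through `1`: the sum of their
principal arguments (with the cut at `1`) is bounded, it agrees with a continuous argument of the
determinant up to an integer multiple of `2π`, and this integer changes only when an eigenvalue
crosses the cut, by at most the multiplicity of `1` (`eventually_sum_arg_bounds`,
`lt_sum_corank`). So the multiplicities in `[0, T]` add up to more than `T ∑ ωⱼ / π - n`, of which
`t = 0` accounts for at most `n`. This leaves more than `T ∑ ωⱼ / π - 2n` in `(0, T]`, which is
better than needed. The monotonicity of the Jacobi curve is not used for the count.
-/

/-! ### Eigenvalues of a unitary matrix -/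

open Polynomial in
theorem Matrix.exists_charpoly_eq_prod {n : ℕ} (U : Matrix (Fin n) (Fin n) ℂ) :
    ∃ l : Fin n → ℂ, U.charpoly = ∏ j, (X - C (l j)) := by
  have hs : U.charpoly.Splits := IsAlgClosed.splits _
  have hcard : U.charpoly.roots.toList.length = n := by
    rw [Multiset.length_toList, ← hs.natDegree_eq_card_roots, U.charpoly_natDegree_eq_dim,
      Fintype.card_fin]
  refine ⟨fun j => U.charpoly.roots.toList.get (j.cast hcard.symm), ?_⟩
  conv_lhs => rw [hs.eq_prod_roots_of_monic U.charpoly_monic, ← U.charpoly.roots.coe_toList,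
    Multiset.map_coe, Multiset.prod_coe]
  generalize U.charpoly.roots.toList = L at *
  subst hcard
  rw [← List.prod_ofFn]
  congr 1
  exact (List.ofFn_getElem_eq_map L fun x => X - C x).symm

open scoped ComplexOrder in
theorem Matrix.norm_eq_one_of_charpoly_isRoot {n : ℕ} {U : Matrix (Fin n) (Fin n) ℂ}
    (hU : star U * U = 1) {z : ℂ} (hz : U.charpoly.eval z = 0) : ‖z‖ = 1 := by
  rw [Matrix.eval_charpoly] at hz
  obtain ⟨v, hv, h⟩ := Matrix.exists_mulVec_eq_zero_iff.2 hz
  have hUv : U.mulVec v = z • v := by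
    rw [Matrix.sub_mulVec, sub_eq_zero] at h
    rw [← h]
    ext i
    simp [Matrix.mulVec_diagonal]
  have h1 : star (U.mulVec v) ⬝ᵥ (U.mulVec v) = star v ⬝ᵥ v := by
    rw [Matrix.star_mulVec, ← Matrix.dotProduct_mulVec, Matrix.mulVec_mulVec,
      ← Matrix.star_eq_conjTranspose, hU, Matrix.one_mulVec]
  rw [hUv, star_smul, smul_dotProduct, dotProduct_smul, smul_smul, smul_eq_mul] at h1
  have h2 : star z * z = 1 := by
    refine mul_right_cancel₀ (b := star v ⬝ᵥ v) ?_ (by rw [h1, one_mul])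
    rwa [Ne, dotProduct_star_self_eq_zero] 
  rw [RCLike.star_def, Complex.conj_mul'] at h2
  have h3 : ‖z‖ ^ 2 = 1 := by exact_mod_cast h2
  exact (pow_eq_one_iff_of_nonneg (norm_nonneg z) two_ne_zero).1 h3

open scoped ComplexOrder in
/-- An eigenvalue of a unitary matrix has no Jordan block: its algebraic multiplicity is its
geometric one. -/
theorem Matrix.rootMultiplicity_charpoly_add_rank {n : ℕ} {U : Matrix (Fin n) (Fin n) ℂ}
    (hU : star U * U = 1) :
    U.charpoly.rootMultiplicity (-1) + (U + 1).rank = n := by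
  have hker : ∀ v, (U + 1).mulVec ((U + 1).mulVec v) = 0 → (U + 1).mulVec v = 0 := by
    intro v hv
    set w := (U + 1).mulVec v with hw
    have h1 : (star (U + 1)).mulVec w = 0 := by
      have : star (U + 1) = star U * (U + 1) := by
        rw [mul_add, hU, mul_one, star_add, star_one, add_comm]
      rw [this, ← Matrix.mulVec_mulVec, hv, Matrix.mulVec_zero]
    rw [← dotProduct_star_self_eq_zero]
    nth_rw 2 [hw]
    rw [Matrix.dotProduct_mulVec]
    rw [← star_star (Matrix.vecMul (star w) (U + 1)), Matrix.star_vecMul, star_star,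
      ← Matrix.star_eq_conjTranspose, h1, star_zero, zero_dotProduct]
  have e1 : (Matrix.toLin' U) - (-1 : ℂ) • (1 : Module.End ℂ (Fin n → ℂ)) =
      Matrix.toLin' (U + 1) := by
    ext v
    simp
  have e2 : Module.End.maxGenEigenspace (Matrix.toLin' U) (-1) =
      LinearMap.ker (Matrix.toLin' (U + 1)) := by
    rw [← e1]
    have : ∀ k, ∀ v, ((Matrix.toLin' (U + 1)) ^ (k + 1)) v = 0 → (Matrix.toLin' (U + 1)) v = 0 := by
      intro k
      induction k with
      | zero => intro v hv; simpa using hv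
      | succ k ih =>
        intro v hv
        rw [pow_succ, Module.End.mul_apply] at hv
        have := ih _ hv
        exact hker v this
    ext v
    rw [Module.End.mem_maxGenEigenspace, LinearMap.mem_ker]
    rw [e1]
    constructor
    · rintro ⟨k, hk⟩
      apply this k
      rw [pow_succ', Module.End.mul_apply, hk, map_zero]
    · intro h
      exact ⟨1, by simpa using h⟩
  have := LinearMap.finrank_maxGenEigenspace_eq (Matrix.toLin' U) (-1)
  rw [e2, Matrix.charpoly_toLin'] at this
  rw [← this, add_comm]
  have h := LinearMap.finrank_range_add_finrank_ker (Matrix.toLin' (U + 1))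
  rw [Module.finrank_fin_fun] at h
  exact h

/-! ### Counting the passages of eigenvalues of a unitary path -/

section UnitaryPath

open Filter Topology

/-- An integer-valued function on the line whose oscillation near each `t₀` is at most `μ t₀` varies
on `[a, b]` by at most the sum of `μ` over `[a, b]`. -/
theorem sub_le_sum_of_local {m : ℝ → ℤ} {μ : ℝ → ℕ}
    (h : ∀ t₀, ∃ s ∈ 𝓝 t₀, ∀ t ∈ s, ∀ t' ∈ s, m t - m t' ≤ μ t₀) (Z : Finset ℝ) :
    ∀ {a b : ℝ}, a ≤ b → (∀ t ∈ Set.Icc a b, μ t ≠ 0 → t ∈ Z) →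
      m b - m a ≤ ∑ t ∈ Z, (μ t : ℤ) := by
  induction Z using Finset.strongInduction with
  | H Z ih =>
  intro a b hab hZ
  have hnn : ∀ Y : Finset ℝ, 0 ≤ ∑ t ∈ Y, (μ t : ℤ) := fun Y =>
    Finset.sum_nonneg fun _ _ => Int.natCast_nonneg _
  rcases Z.eq_empty_or_nonempty with rfl | ⟨z, hz⟩
  · have hcont : ContinuousOn m (Set.Icc a b) := by
      intro t₀ ht₀
      have h0 : μ t₀ = 0 := by
        by_contra hne
        exact absurd (hZ t₀ ht₀ hne) (Finset.notMem_empty _)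
      obtain ⟨s, hs, hm⟩ := h t₀
      have : m =ᶠ[𝓝 t₀] fun _ => m t₀ := by
        filter_upwards [hs] with t ht
        have h1 := hm t ht t₀ (mem_of_mem_nhds hs)
        have h2 := hm t₀ (mem_of_mem_nhds hs) t ht
        omega
      exact (continuousAt_const.congr this.symm).continuousWithinAt
    have := isPreconnected_Icc.constant hcont (Set.right_mem_Icc.2 hab) (Set.left_mem_Icc.2 hab)
    rw [this]; simp
  · by_cases hzab : z ∈ Set.Icc a b
    swap
    · refine (ih (Z.erase z) (Finset.erase_ssubset hz) hab fun t ht h0 => ?_).trans ?_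
      · exact Finset.mem_erase.2 ⟨fun e => hzab (e ▸ ht), hZ t ht h0⟩
      · rw [← Finset.add_sum_erase Z _ hz]
        have := Int.natCast_nonneg (μ z)
        linarith
    -- Cut `[a, b]` at the ends of a small interval around one point `z` of `Z`.
    obtain ⟨s, hs, hm⟩ := h z
    obtain ⟨δ, hδ, hball⟩ := Metric.mem_nhds_iff.1 hs
    have hmem : ∀ t, |t - z| ≤ δ / 2 → t ∈ s := fun t ht =>
      hball (by rw [Metric.mem_ball, Real.dist_eq]; linarith)
    have hl : m (max a (z - δ / 2)) - m a ≤ ∑ t ∈ Z with t < z, (μ t : ℤ) := by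
      rcases hzab.1.eq_or_lt with e | hlt
      · rw [max_eq_left (by linarith), sub_self]
        exact hnn _
      · refine ih _ ⟨Finset.filter_subset _ _, fun hsub => ?_⟩ (le_max_left _ _) ?_
        · exact lt_irrefl z (Finset.mem_filter.1 (hsub hz)).2
        · intro t ht h0
          have : t < z := ht.2.trans_lt (max_lt hlt (by linarith))
          exact Finset.mem_filter.2 ⟨hZ t ⟨ht.1, this.le.trans hzab.2⟩ h0, this⟩
    have hr : m b - m (min b (z + δ / 2)) ≤ ∑ t ∈ Z with z < t, (μ t : ℤ) := by
      rcases hzab.2.eq_or_lt with e | hlt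
      · rw [min_eq_left (by linarith), sub_self]
        exact hnn _
      · refine ih _ ⟨Finset.filter_subset _ _, fun hsub => ?_⟩ (min_le_left _ _) ?_
        · exact lt_irrefl z (Finset.mem_filter.1 (hsub hz)).2
        · intro t ht h0
          have : z < t := (lt_min hlt (by linarith)).trans_le ht.1
          exact Finset.mem_filter.2 ⟨hZ t ⟨hzab.1.trans this.le, ht.2⟩ h0, this⟩
    have hmid := hm (min b (z + δ / 2)) (hmem _ (by
        rw [abs_le]
        exact ⟨by linarith [le_min hzab.2 (by linarith : z ≤ z + δ / 2)],
          by linarith [min_le_right b (z + δ / 2)]⟩))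
      (max a (z - δ / 2)) (hmem _ (by
        rw [abs_le]
        exact ⟨by linarith [le_max_right a (z - δ / 2)],
          by linarith [max_le hzab.1 (by linarith : z - δ / 2 ≤ z)]⟩))
    have hsum : ∑ t ∈ Z, (μ t : ℤ) =
        μ z + (∑ t ∈ Z with t < z, (μ t : ℤ) + ∑ t ∈ Z with z < t, (μ t : ℤ)) := by
      rw [← Finset.add_sum_erase Z _ hz, ← Finset.sum_filter_add_sum_filter_not (Z.erase z) (· < z)]
      congr 2 <;> refine Finset.sum_congr ?_ fun _ _ => rfl
      · ext t; simp only [Finset.mem_filter, Finset.mem_erase]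
        exact ⟨fun h => ⟨h.1.2, h.2⟩, fun h => ⟨⟨h.2.ne, h.1⟩, h.2⟩⟩
      · ext t; simp only [Finset.mem_filter, Finset.mem_erase, not_lt]
        exact ⟨fun h => ⟨h.1.2, lt_of_le_of_ne h.2 (Ne.symm h.1.1)⟩,
          fun h => ⟨⟨h.2.ne', h.1⟩, h.2.le⟩⟩
    linarith

open Polynomial in
/-- Near `t₀`, the sum of the principal arguments of the eigenvalues of a path of unitary matrices
stays in an interval of length about `2π` times the multiplicity of `-1` at `t₀`: only the
eigenvalues that tend to `-1` may be seen on either side of the cut of `arg`. The eigenvalues `l t`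
are listed in an arbitrary order, which may depend discontinuously on `t`. -/
theorem eventually_sum_arg_bounds {n : ℕ} {U : ℝ → Matrix (Fin n) (Fin n) ℂ} (hU : Continuous U)
    {l : ℝ → Fin n → ℂ} (hl : ∀ t j, ‖l t j‖ = 1)
    (hchar : ∀ t, (U t).charpoly = ∏ j, (X - C (l t j))) (t₀ : ℝ) {ε : ℝ} (hε : 0 < ε) :
    ∃ c : ℝ, ∀ᶠ t in 𝓝 t₀, c - ε < ∑ j, (l t j).arg ∧
      ∑ j, (l t j).arg < c + 2 * Real.pi * (U t₀).charpoly.rootMultiplicity (-1) + ε := by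
  classical
  set R := (U t₀).charpoly.roots with hR
  have hroots : ∀ x : Fin n → ℂ, (U t₀).charpoly = ∏ j, (X - C (x j)) →
      R = Finset.univ.val.map x := by
    intro x hx
    rw [hR, hx, ← Polynomial.roots_multiset_prod_X_sub_C (Finset.univ.val.map x), Multiset.map_map]
    rfl
  refine ⟨(R.map fun z => if z = -1 then -Real.pi else z.arg).sum, ?_⟩
  -- By compactness the list `l t` has a limit `x` along every ultrafilter converging to `t₀`, and
  -- `x` is a list of the eigenvalues of `U t₀`.
  refine Filter.mem_iff_ultrafilter.2 fun g hg => ?_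
  have hK : IsCompact (Set.univ.pi fun _ : Fin n => Metric.sphere (0 : ℂ) 1) :=
    isCompact_univ_pi fun _ => isCompact_sphere _ _
  obtain ⟨x, -, hx⟩ := hK.ultrafilter_le_nhds (g.map l) (by
    rw [le_principal_iff, Ultrafilter.mem_coe, Ultrafilter.mem_map]
    exact Filter.univ_mem' fun t => by simp [hl])
  have hx : Tendsto l g (𝓝 x) := hx
  have hxj : ∀ j, Tendsto (fun t => l t j) g (𝓝 (x j)) := fun j => (tendsto_pi_nhds.1 hx) j
  have hx1 : ∀ j, ‖x j‖ = 1 := fun j =>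
    tendsto_nhds_unique ((hxj j).norm) (by simp [hl])
  have hxchar : (U t₀).charpoly = ∏ j, (X - C (x j)) := by
    refine Polynomial.funext fun z => ?_
    have h1 : Tendsto (fun t => (U t).charpoly.eval z) g (𝓝 ((U t₀).charpoly.eval z)) := by
      simp only [Matrix.eval_charpoly]
      have : Continuous fun t => ((Matrix.scalar (Fin n) z) - U t).det := by fun_prop
      exact (this.tendsto t₀).mono_left hg
    have h2 : Tendsto (fun t => (U t).charpoly.eval z) g (𝓝 (∏ j, (z - x j))) := by
      simp only [hchar, eval_prod, eval_sub, eval_X, eval_C]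
      exact tendsto_finsetProd _ fun j _ => tendsto_const_nhds.sub (hxj j)
    rw [tendsto_nhds_unique h1 h2]
    simp [eval_prod]
  have hc : (R.map fun z => if z = -1 then -Real.pi else z.arg).sum =
      ∑ j, if x j = -1 then -Real.pi else (x j).arg := by
    rw [hroots x hxchar, Multiset.map_map]; rfl
  have hd : ((U t₀).charpoly.rootMultiplicity (-1) : ℝ) = ∑ j, if x j = -1 then (1 : ℝ) else 0 := by
    rw [← Polynomial.count_roots, ← hR, hroots x hxchar, Multiset.count_map, Finset.sum_boole]
    simp [Finset.card_def, eq_comm]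
  have hn : (0 : ℝ) < n + 1 := by positivity
  have hε' : 0 < ε / (n + 1) := by positivity
  have key : ∀ j, ∀ᶠ t in (g : Filter ℝ),
      (if x j = -1 then -Real.pi else (x j).arg) - ε / (n + 1) ≤ (l t j).arg ∧
      (l t j).arg ≤ (if x j = -1 then -Real.pi else (x j).arg) +
        2 * Real.pi * (if x j = -1 then (1 : ℝ) else 0) + ε / (n + 1) := by
    intro j
    by_cases h : x j = -1
    · refine Filter.Eventually.of_forall fun t => ?_
      have := Complex.arg_le_pi (l t j)
      have := Complex.neg_pi_lt_arg (l t j)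
      simp only [h, if_true]
      constructor <;> linarith
    · have hs : x j ∈ Complex.slitPlane := by
        rw [Complex.mem_slitPlane_iff_arg]
        refine ⟨fun ha => h ?_, fun h0 => by simpa [h0] using hx1 j⟩
        have := Complex.norm_mul_exp_arg_mul_I (x j)
        rw [hx1, ha] at this
        simpa [Complex.exp_pi_mul_I] using this.symm
      have ht := (Complex.continuousAt_arg hs).tendsto.comp (hxj j)
      have := ht.eventually (Metric.ball_mem_nhds _ hε')
      filter_upwards [this] with t ht
      rw [Real.dist_eq, abs_lt] at ht
      simp only [h, if_false, Function.comp_apply] at ht ⊢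
      constructor <;> linarith
  have hlt : n * (ε / (n + 1)) < ε := by
    rw [← mul_div_assoc, div_lt_iff₀ hn]
    nlinarith
  filter_upwards [Filter.eventually_all.2 key] with t ht
  rw [hc, hd]
  have h1 := Finset.sum_le_sum fun j (_ : j ∈ Finset.univ) => (ht j).1
  have h2 := Finset.sum_le_sum fun j (_ : j ∈ Finset.univ) => (ht j).2
  simp only [Finset.sum_sub_distrib, Finset.sum_add_distrib, Finset.sum_const, Finset.card_univ,
    Fintype.card_fin, nsmul_eq_mul, ← Finset.mul_sum] at h1 h2
  constructor <;> linarith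

/-- If the determinant of a path of unitary matrices turns by the angle `-2Tσ` during `[0, T]`, then
the eigenvalue `-1` occurs, with multiplicity, more than `Tσ/π - n` times. Here `Z` is a finite set
that contains all the times at which `-1` is an eigenvalue. -/
theorem lt_sum_corank {n : ℕ} (hn : 0 < n) {U : ℝ → Matrix (Fin n) (Fin n) ℂ} (hU : Continuous U)
    (hunit : ∀ t, star (U t) * U t = 1) {σ : ℝ} {c : ℂ}
    (hdet : ∀ t : ℝ, (U t).det = c * Complex.exp ((-(2 * t * σ) : ℝ) * Complex.I))
    {T : ℝ} (hT : 0 ≤ T) (Z : Finset ℝ) (hZ : ∀ t ∈ Set.Icc 0 T, (U t + 1).rank ≠ n → t ∈ Z) :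
    T * σ / Real.pi - n < ∑ t ∈ Z, ((n : ℝ) - (U t + 1).rank) := by
  choose l hchar using fun t => (U t).exists_charpoly_eq_prod
  have hl : ∀ t j, ‖l t j‖ = 1 := fun t j =>
    Matrix.norm_eq_one_of_charpoly_isRoot (hunit t) (by
      rw [hchar, Polynomial.eval_prod]
      exact Finset.prod_eq_zero (Finset.mem_univ j) (by simp))
  -- The argument of the determinant, computed from the principal arguments of the eigenvalues; it
  -- differs from the continuous function `t ↦ A 0 - 2tσ` by the integer multiple `m t` of `2π`.
  set A : ℝ → ℝ := fun t => ∑ j, (l t j).arg with hA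
  have hexp : ∀ t, Complex.exp (((A t + 2 * t * σ : ℝ) : ℂ) * Complex.I) = c := by
    intro t
    have h1 : Complex.exp ((A t : ℂ) * Complex.I) = (U t).det := by
      rw [Matrix.det_eq_sign_charpoly_coeff, hchar, Polynomial.coeff_zero_eq_eval_zero,
        Polynomial.eval_prod, hA]
      push_cast
      rw [Finset.sum_mul, Complex.exp_sum]
      simp only [Polynomial.eval_sub, Polynomial.eval_X, Polynomial.eval_C, zero_sub]
      rw [Finset.prod_neg, ← mul_assoc]
      simp only [Fintype.card_fin, Finset.card_univ]
      rw [← mul_pow, neg_one_mul, neg_neg, one_pow, one_mul]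
      refine Finset.prod_congr rfl fun j _ => ?_
      have := Complex.norm_mul_exp_arg_mul_I (l t j)
      rwa [hl, Complex.ofReal_one, one_mul] at this
    rw [Complex.ofReal_add, add_mul, Complex.exp_add, h1, hdet, mul_assoc, ← Complex.exp_add,
      ← add_mul, ← Complex.ofReal_add, neg_add_cancel]
    simp
  have hint : ∀ t, ∃ m : ℤ, A t + 2 * t * σ = A 0 + m * (2 * Real.pi) := by
    intro t
    have := (hexp t).trans (hexp 0).symm
    obtain ⟨m, hm⟩ := Complex.exp_eq_exp_iff_exists_int.1 this
    refine ⟨m, ?_⟩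
    have h2 := congrArg Complex.im hm
    simpa using h2
  choose m hm using hint
  have hπ := Real.pi_pos
  have hlocal : ∀ t₀, ∃ s ∈ 𝓝 t₀, ∀ t ∈ s, ∀ t' ∈ s,
      m t - m t' ≤ ((U t₀).charpoly.rootMultiplicity (-1) : ℕ) := by
    intro t₀
    obtain ⟨a, ha⟩ := eventually_sum_arg_bounds hU hl hchar t₀ (ε := 1) one_pos
    have hc : ∀ᶠ t in 𝓝 t₀, |2 * t * σ - 2 * t₀ * σ| < 1 := by
      have : Continuous fun t : ℝ => 2 * t * σ := by fun_prop
      exact (this.tendsto t₀).eventually (Metric.ball_mem_nhds _ one_pos)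
    refine ⟨_, ha.and hc, fun t ht t' ht' => ?_⟩
    obtain ⟨⟨h1, h2⟩, h3⟩ := ht
    obtain ⟨⟨h1', h2'⟩, h3'⟩ := ht'
    rw [abs_lt] at h3 h3'
    have e1 := hm t
    have e2 := hm t'
    have hπ3 := Real.pi_gt_three
    have : (m t - m t' : ℝ) * (2 * Real.pi) <
        ((U t₀).charpoly.rootMultiplicity (-1) + 1) * (2 * Real.pi) := by
      simp only [hA] at e1 e2
      nlinarith
    have := lt_of_mul_lt_mul_right this (by positivity)
    have h4 : m t - m t' < (((U t₀).charpoly.rootMultiplicity (-1) : ℕ) : ℤ) + 1 := by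
      exact_mod_cast this
    omega
  have hrank : ∀ t, (U t).charpoly.rootMultiplicity (-1) + (U t + 1).rank = n := fun t =>
    Matrix.rootMultiplicity_charpoly_add_rank (hunit t)
  have hsum := sub_le_sum_of_local hlocal Z hT fun t ht h0 => hZ t ht (by
    have := hrank t
    omega)
  have hsum' : ((m T - m 0 : ℤ) : ℝ) ≤ ∑ t ∈ Z, ((n : ℝ) - (U t + 1).rank) := by
    have e : ∑ t ∈ Z, ((n : ℝ) - (U t + 1).rank) =
        ((∑ t ∈ Z, (((U t).charpoly.rootMultiplicity (-1) : ℕ) : ℤ) : ℤ) : ℝ) := by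
      push_cast
      refine Finset.sum_congr rfl fun t _ => ?_
      have : (((U t).charpoly.rootMultiplicity (-1) + (U t + 1).rank : ℕ) : ℝ) = n := by
        rw [hrank t]
      push_cast at this
      linarith
    rw [e]
    exact_mod_cast hsum
  refine lt_of_lt_of_le ?_ hsum'
  have hAT : -(n * Real.pi) < A T := by
    have : ∑ j : Fin n, (-Real.pi) < A T :=
      Finset.sum_lt_sum_of_nonempty ⟨⟨0, hn⟩, Finset.mem_univ _⟩ fun j _ =>
        Complex.neg_pi_lt_arg _
    simpa using this
  have hA0 : A 0 ≤ n * Real.pi := by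
    have : A 0 ≤ ∑ j : Fin n, Real.pi := Finset.sum_le_sum fun j _ => Complex.arg_le_pi _
    simpa using this
  have e0 := hm 0
  have eT := hm T
  have hm0 : (m 0 : ℝ) = 0 := by
    have : (m 0 : ℝ) * (2 * Real.pi) = 0 := by linarith
    rcases mul_eq_zero.1 this with h | h
    · exact h
    · linarith
  push_cast
  rw [hm0, sub_zero]
  rw [sub_lt_iff_lt_add, div_lt_iff₀ hπ]
  nlinarith

end UnitaryPath

/-! ### Real and imaginary parts of complex matrices -/

open Matrix

/-- The entrywise inclusion of real matrices into complex ones. -/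
abbrev Matrix.toComplex {m n : Type*} (A : Matrix m n ℝ) : Matrix m n ℂ := A.map Complex.ofReal

section ReIm

variable {l m n : Type*} [Fintype m] (X : Matrix l m ℂ) (Y : Matrix m n ℂ)

theorem Matrix.map_re_mul : (X * Y).map Complex.re =
    X.map Complex.re * Y.map Complex.re - X.map Complex.im * Y.map Complex.im := by
  ext i j
  simp [Matrix.mul_apply, Complex.re_sum, Complex.mul_re, Finset.sum_sub_distrib]

theorem Matrix.map_im_mul : (X * Y).map Complex.im =
    X.map Complex.re * Y.map Complex.im + X.map Complex.im * Y.map Complex.re := by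
  ext i j
  simp [Matrix.mul_apply, Complex.im_sum, Complex.mul_im, Finset.sum_add_distrib]

end ReIm

/-- Complex `n × n` matrices as real endomorphisms of the phase space, under the identification
of `(p, x)` with `p + i x`. -/
def Matrix.realification (n : ℕ) :
    Matrix (Fin n) (Fin n) ℂ →+* Matrix (Fin n ⊕ Fin n) (Fin n ⊕ Fin n) ℝ where
  toFun X := fromBlocks (X.map Complex.re) (-X.map Complex.im) (X.map Complex.im) (X.map Complex.re)
  map_one' := by
    rw [← fromBlocks_one]
    congr 1 <;> ext i j <;> by_cases h : i = j <;> simp [h, one_apply]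
  map_zero' := by
    rw [← fromBlocks_zero]
    congr 1 <;> ext i j <;> simp
  map_add' X Y := by
    rw [fromBlocks_add]
    congr 1 <;> ext i j <;> simp [add_comm]
  map_mul' X Y := by
    rw [fromBlocks_multiply, map_re_mul, map_im_mul]
    congr 1 <;> simp [sub_eq_add_neg, add_comm]

theorem Matrix.continuous_realification (n : ℕ) : Continuous (realification n) := by
  have hre := Complex.continuous_re
  have him := Complex.continuous_im
  exact (continuous_id.matrix_map hre).matrix_fromBlocks (continuous_id.matrix_map him).neg
    (continuous_id.matrix_map him) (continuous_id.matrix_map hre)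

open scoped Matrix.Norms.Operator in
theorem Matrix.realification_exp {n : ℕ} (X : Matrix (Fin n) (Fin n) ℂ) :
    realification n (NormedSpace.exp X) = NormedSpace.exp (realification n X) :=
  NormedSpace.map_exp (realification n) (continuous_realification n) X

/-- A real basis of the real kernel spans the complex kernel. -/
theorem Matrix.rank_le_rank_toComplex {m n : ℕ} (A : Matrix (Fin m) (Fin n) ℝ) :
    A.rank ≤ A.toComplex.rank := by
  set b := Module.finBasis ℝ (LinearMap.ker A.mulVecLin)
  have hmem : ∀ v : Fin n → ℝ, A *ᵥ v = 0 → (fun i => (v i : ℂ)) ∈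
      Submodule.span ℂ (Set.range fun k => fun i => ((b k : Fin n → ℝ) i : ℂ)) := by
    intro v hv
    have hr := congrArg Subtype.val (b.sum_repr ⟨v, hv⟩)
    have : (fun i => (v i : ℂ)) =
        ∑ k, (b.repr ⟨v, hv⟩ k : ℂ) • fun i => ((b k : Fin n → ℝ) i : ℂ) := by
      ext i
      have := congrFun hr i
      simp only [Submodule.coe_sum, Submodule.coe_smul, Finset.sum_apply, Pi.smul_apply,
        smul_eq_mul] at this
      rw [← this]
      simp
    rw [this]
    exact Submodule.sum_mem _ fun k _ => Submodule.smul_mem _ _ (Submodule.subset_span ⟨k, rfl⟩)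
  have hle : LinearMap.ker A.toComplex.mulVecLin ≤
      Submodule.span ℂ (Set.range fun k => fun i => ((b k : Fin n → ℝ) i : ℂ)) := by
    intro v hv
    have hv : A.toComplex *ᵥ v = 0 := hv
    have hre : A *ᵥ (fun i => (v i).re) = 0 := by
      ext i
      have := congrArg Complex.re (congrFun hv i)
      simpa [Matrix.mulVec, dotProduct] using this
    have him : A *ᵥ (fun i => (v i).im) = 0 := by
      ext i
      have := congrArg Complex.im (congrFun hv i)
      simpa [Matrix.mulVec, dotProduct] using this
    have : v = (fun i => ((v i).re : ℂ)) + Complex.I • fun i => ((v i).im : ℂ) := by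
      ext i
      simp [mul_comm Complex.I, Complex.re_add_im]
    rw [this]
    exact Submodule.add_mem _ (hmem _ hre) (Submodule.smul_mem _ _ (hmem _ him))
  have h1 := (Submodule.finrank_mono hle).trans (finrank_range_le_card _)
  rw [Fintype.card_fin] at h1
  have h2 := LinearMap.finrank_range_add_finrank_ker A.mulVecLin
  have h3 := LinearMap.finrank_range_add_finrank_ker A.toComplex.mulVecLin
  rw [Module.finrank_fin_fun] at h2 h3
  change A.rank + _ = _ at h2
  change A.toComplex.rank + _ = _ at h3
  omega

theorem Matrix.IsSymm.eq_zero_of_forall_dotProduct {ι : Type*} [Fintype ι] [DecidableEq ι]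
    {S : Matrix ι ι ℝ} (hS : S.IsSymm) (h : ∀ z, z ⬝ᵥ S *ᵥ z = 0) : S = 0 := by
  ext i j
  have h1 := h (Pi.single i 1 + Pi.single j 1)
  have h2 := h (Pi.single i 1)
  have h3 := h (Pi.single j 1)
  have h4 := hS.apply i j
  simp only [mulVec_add, mulVec_single_one, add_dotProduct, dotProduct_add, single_one_dotProduct,
    col_apply] at h1 h2 h3
  simp only [zero_apply]
  linarith

/-! ### Lagrangian frames and the Souriau map -/

/-- The complex matrix `a + i b`. -/
def Matrix.ofReIm {n : ℕ} (a b : Matrix (Fin n) (Fin n) ℝ) : Matrix (Fin n) (Fin n) ℂ :=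
  Matrix.of fun i j => ⟨a i j, b i j⟩

section LagrangianFrame

variable {n : ℕ} {a b : Matrix (Fin n) (Fin n) ℝ}

@[simp] theorem Matrix.map_re_ofReIm : (ofReIm a b).map Complex.re = a := rfl
@[simp] theorem Matrix.map_im_ofReIm : (ofReIm a b).map Complex.im = b := rfl

@[simp] theorem Matrix.map_re_conjTranspose_ofReIm : (ofReIm a b)ᴴ.map Complex.re = aᵀ := by
  ext i j; simp [ofReIm]
@[simp] theorem Matrix.map_im_conjTranspose_ofReIm : (ofReIm a b)ᴴ.map Complex.im = -bᵀ := by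
  ext i j; simp [ofReIm]

/-- The condition `aᵀ b = bᵀ a` says that the real span of the columns of `a + i b` is isotropic,
which makes their Hermitian Gram matrix real. -/
theorem Matrix.gram_ofReIm (hab : aᵀ * b = bᵀ * a) :
    (ofReIm a b)ᴴ * ofReIm a b = (aᵀ * a + bᵀ * b).toComplex := by
  have hre := map_re_mul (ofReIm a b)ᴴ (ofReIm a b)
  have him := map_im_mul (ofReIm a b)ᴴ (ofReIm a b)
  simp only [map_re_ofReIm, map_im_ofReIm, map_re_conjTranspose_ofReIm,
    map_im_conjTranspose_ofReIm, hab, neg_mul, add_neg_cancel, sub_neg_eq_add] at hre him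
  ext i j
  apply Complex.ext
  · simpa using congrFun (congrFun hre i) j
  · simpa using congrFun (congrFun him i) j

/-- The Gram matrix, being real, equals its entrywise conjugate. -/
theorem Matrix.gram_ofReIm' (hab : aᵀ * b = bᵀ * a) :
    (ofReIm a b)ᵀ * ((ofReIm a b)ᴴ)ᵀ = (ofReIm a b)ᴴ * ofReIm a b := by
  have h := gram_ofReIm hab
  have h2 := congrArg transpose h
  rw [transpose_mul] at h2
  rw [h2, h, ← transpose_map]
  simp

/-- `2 i Im Y = Y - conj Y`. -/
theorem Matrix.toComplex_map_im (Y : Matrix (Fin n) (Fin n) ℂ) :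
    (Y.map Complex.im).toComplex = (-Complex.I / 2) • (Y - Yᴴᵀ) := by
  ext i j
  apply Complex.ext <;> simp
  ring

/-- The Souriau map: for a Lagrangian frame `Z` and a symmetric unitary `D`, the failure of `D Z ℝⁿ`
to be transversal to `Z ℝⁿ` is measured by the eigenvalue `1` of the unitary matrix `D W* D W`. Here
`W = Z Z̄⁻¹` depends on the Lagrangian subspace only. -/
theorem Matrix.exists_souriau (hab : aᵀ * b = bᵀ * a) (hZ : (ofReIm a b).det ≠ 0) :
    ∃ W : Matrix (Fin n) (Fin n) ℂ, star W * W = 1 ∧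
      ∀ D : Matrix (Fin n) (Fin n) ℂ, Dᵀ = D → star D * D = 1 →
        (((ofReIm a b)ᴴ * D * ofReIm a b).map Complex.im).toComplex.rank =
          (1 - D * star W * D * W).rank := by
  set Z := ofReIm a b with hZdef
  have hG : Zᵀ * Zᴴᵀ = Zᴴ * Z := gram_ofReIm' hab
  have hZu : IsUnit Z.det := isUnit_iff_ne_zero.2 hZ
  have hZTu : IsUnit Zᵀ.det := by rwa [det_transpose]
  have hZbu : IsUnit Zᴴᵀ.det := by
    rw [det_transpose, det_conjTranspose]
    exact hZu.star
  have hstar : star (Z * Zᴴᵀ⁻¹) = Zᵀ⁻¹ * Zᴴ := by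
    rw [star_mul, star_eq_conjTranspose, star_eq_conjTranspose, conjTranspose_nonsing_inv]
    congr 2
    ext i j
    simp
  have hW1 : Z * Zᴴᵀ⁻¹ * Zᴴᵀ = Z := by rw [mul_assoc, nonsing_inv_mul _ hZbu, mul_one]
  have hW2 : Zᵀ * star (Z * Zᴴᵀ⁻¹) = Zᴴ := by
    rw [hstar, ← mul_assoc, mul_nonsing_inv _ hZTu, one_mul]
  refine ⟨Z * Zᴴᵀ⁻¹, ?_, fun D hDs hD => ?_⟩
  · rw [hstar, mul_assoc, ← mul_assoc Zᴴ, ← hG, mul_assoc, mul_nonsing_inv _ hZbu, mul_one,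
      nonsing_inv_mul _ hZTu]
  · set W := Z * Zᴴᵀ⁻¹ with hW
    have h1 : Zᴴ * D * Z = Zᵀ * (star W * D * W) * Zᴴᵀ := by
      calc Zᴴ * D * Z = (Zᵀ * star W) * D * (W * Zᴴᵀ) := by rw [hW2, hW1]
        _ = _ := by simp only [mul_assoc]
    have h2 : (Zᴴ * D * Z)ᴴᵀ = Zᵀ * star D * Zᴴᵀ := by
      have hDc : Dᴴᵀ = star D := by
        conv_rhs => rw [← hDs]
        rfl
      rw [conjTranspose_mul, conjTranspose_mul, conjTranspose_conjTranspose, transpose_mul,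
        transpose_mul, hDc]
    have h3 : ((Zᴴ * D * Z).map Complex.im).toComplex =
        ((Complex.I / 2) • (Zᵀ * star D)) * (1 - D * star W * D * W) * Zᴴᵀ := by
      have h4 : Zᵀ * star D * (1 - D * star W * D * W) =
          Zᵀ * star D - Zᵀ * (star W * D * W) := by
        rw [mul_sub, mul_one]
        congr 1
        simp only [mul_assoc]
        rw [← mul_assoc (star D), hD, one_mul]
      rw [toComplex_map_im, h2, h1, smul_mul_assoc, smul_mul_assoc, h4, sub_mul, neg_div, neg_smul,
        ← smul_neg, neg_sub]
    rw [h3, rank_mul_eq_left_of_isUnit_det _ _ hZbu, rank_mul_eq_right_of_isUnit_det]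
    rw [det_smul, det_mul]
    refine IsUnit.mul (isUnit_iff_ne_zero.2 (pow_ne_zero _ (by simp))) (hZTu.mul ?_)
    exact isUnit_det_of_right_inverse hD

end LagrangianFrame

theorem Matrix.trace_mul_mul_transpose_pos {n k : ℕ} {G : Matrix (Fin n) (Fin n) ℝ}
    (hG : G.PosDef) {B : Matrix (Fin n) (Fin k) ℝ} (hB : B ≠ 0) :
    0 < (G * (B * Bᵀ)).trace := by
  have h : (G * (B * Bᵀ)).trace = ∑ j, B.col j ⬝ᵥ G *ᵥ B.col j := by
    rw [← Matrix.mul_assoc, trace_mul_comm]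
    rfl
  have hnn : ∀ x : Fin n → ℝ, 0 ≤ x ⬝ᵥ G *ᵥ x := fun x => by
    simpa using hG.posSemidef.dotProduct_mulVec_nonneg x
  obtain ⟨j, hj⟩ : ∃ j, B.col j ≠ 0 := by
    by_contra! hcon
    exact hB (by ext i j; exact congrFun (hcon j) i)
  rw [h]
  exact Finset.sum_pos' (fun j _ => hnn _) ⟨j, Finset.mem_univ j, by
    simpa using hG.dotProduct_mulVec_pos hj⟩

/-- In an orthonormal basis of a Lagrangian subspace, `∑ ωⱼ |zⱼ|²` has trace `∑ ωⱼ`. The frame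
`a + i b` need not be orthonormal, whence the inverse of its Gram matrix. -/
theorem Matrix.sum_eq_trace_gram_inv {n : ℕ} {a b : Matrix (Fin n) (Fin n) ℝ}
    (hab : aᵀ * b = bᵀ * a) (hG : IsUnit (aᵀ * a + bᵀ * b).det) (ω : Fin n → ℝ) :
    ∑ j, ω j = ((aᵀ * a + bᵀ * b)⁻¹ *
      (aᵀ * diagonal ω * a + bᵀ * diagonal ω * b)).trace := by
  set Z := ofReIm a b with hZdef
  set G := aᵀ * a + bᵀ * b with hGdef
  have hgram : Zᴴ * Z = G.toComplex := gram_ofReIm hab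
  have hinv : G⁻¹.toComplex * Zᴴ * Z = 1 := by
    have h1 : G⁻¹.toComplex * G.toComplex = 1 := by
      rw [← map_one Complex.ofRealHom.mapMatrix, ← nonsing_inv_mul G hG, map_mul]
      rfl
    rw [mul_assoc, hgram, h1]
  have htr : ∑ j, (ω j : ℂ) = (G⁻¹.toComplex * (Zᴴ * (diagonal ω).toComplex * Z)).trace := by
    have h2 : Z * (G⁻¹.toComplex * Zᴴ) = 1 := mul_eq_one_comm.1 hinv
    rw [show G⁻¹.toComplex * (Zᴴ * (diagonal ω).toComplex * Z) =
        (G⁻¹.toComplex * Zᴴ) * ((diagonal ω).toComplex * Z) by simp only [mul_assoc],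
      trace_mul_comm, mul_assoc, h2, mul_one]
    simp [trace]
  have hre := congrArg Complex.re htr
  have h3 : ∀ X : Matrix (Fin n) (Fin n) ℂ, X.trace.re = (X.map Complex.re).trace := fun X => by
    simp [trace]
  have h4 : ∀ A : Matrix (Fin n) (Fin n) ℝ, A.toComplex.map Complex.re = A ∧
      A.toComplex.map Complex.im = 0 := fun A => ⟨by ext; simp, by ext; simp⟩
  rw [h3] at hre
  simp only [map_re_mul, map_im_mul, (h4 _).1, (h4 _).2, hZdef, map_re_ofReIm, map_im_ofReIm,
    map_re_conjTranspose_ofReIm, map_im_conjTranspose_ofReIm, zero_mul, mul_zero, sub_zero,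
    zero_add, neg_mul, sub_neg_eq_add] at hre
  rw [← hre]
  simp

/-! ### The linear quadratic problem in normal coordinates -/

namespace LQProblem

variable {n k : ℕ} (L : LQProblem n k)

/-- The matrix of the endpoint map, which takes the initial covector `p` to the `x` component of
`exp (t Ω ℋ) (p, 0)`. -/
noncomputable def endpointMatrix (t : ℝ) : Matrix (Fin n) (Fin n) ℝ :=
  (NormedSpace.exp (t • (symplecticForm n * L.hamiltonianMatrix))).toBlocks₂₁

/-- `J(t) ∩ 𝒱` is the isomorphic image of the kernel of the endpoint map. -/
theorem multiplicity_eq (t : ℝ) : L.multiplicity t = n - (L.endpointMatrix t).rank := by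
  set E := NormedSpace.exp (t • (symplecticForm n * L.hamiltonianMatrix)) with hE
  have hEinj : Function.Injective E.mulVecLin :=
    mulVec_injective_iff_isUnit.2 (isUnit_exp _)
  let ι : (Fin n → ℝ) →ₗ[ℝ] PhaseSpace n :=
    { toFun := fun p => Sum.elim p 0
      map_add' := fun p q => by ext (i | i) <;> simp
      map_smul' := fun c p => by ext (i | i) <;> simp }
  have hιinj : Function.Injective ι := fun p q h => by
    ext i
    exact congrFun h (Sum.inl i)
  have hinr : ∀ p i, (E *ᵥ ι p) (Sum.inr i) = (L.endpointMatrix t *ᵥ p) i := by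
    intro p i
    have h0 := fromBlocks_mulVec E.toBlocks₁₁ E.toBlocks₁₂ E.toBlocks₂₁ E.toBlocks₂₂ (ι p)
    rw [fromBlocks_toBlocks] at h0
    have h1 : (ι p) ∘ Sum.inl = p := rfl
    have h2 : (ι p) ∘ Sum.inr = 0 := rfl
    rw [h0, Sum.elim_inr, h1, h2, mulVec_zero, add_zero]
    rfl
  have hset : L.jacobiCurve t ⊓ verticalSpace n =
      (LinearMap.ker (L.endpointMatrix t).mulVecLin).map (E.mulVecLin ∘ₗ ι) := by
    ext z
    simp only [jacobiCurve, Submodule.mem_inf, Submodule.mem_map, LinearMap.mem_ker,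
      LinearMap.comp_apply, ← hE]
    constructor
    · rintro ⟨⟨y, hy, rfl⟩, hz⟩
      have hy' : ι (y ∘ Sum.inl) = y := by
        ext (i | i)
        · rfl
        · exact (hy i).symm
      refine ⟨y ∘ Sum.inl, ?_, by rw [hy']⟩
      ext i
      rw [mulVecLin_apply, ← hinr, hy']
      exact hz i
    · rintro ⟨p, hp, rfl⟩
      exact ⟨⟨ι p, fun i => rfl, rfl⟩, fun i => (hinr p i).trans (congrFun hp i)⟩
  have hfr : L.multiplicity t =
      Module.finrank ℝ (LinearMap.ker (L.endpointMatrix t).mulVecLin) := by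
    rw [multiplicity, hset]
    exact (Submodule.equivMapOfInjective _ (fun _ _ h => hιinj (hEinj h)) _).finrank_eq.symm
  have h := LinearMap.finrank_range_add_finrank_ker (L.endpointMatrix t).mulVecLin
  rw [Module.finrank_fin_fun] at h
  change (L.endpointMatrix t).rank + _ = _ at h
  omega

variable {L}

theorem isConjugateTime_iff {t : ℝ} : L.IsConjugateTime t ↔ L.multiplicity t ≠ 0 :=
  (Submodule.finrank_eq_zero (R := ℝ)).not.symm

theorem IsControllable.ne_zero (hn : 0 < n) (hL : L.IsControllable) : L.B ≠ 0 := by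
  rintro hB
  obtain ⟨m, -, hm⟩ := hL
  have : L.kalmanMatrix m = 0 := by
    ext i c
    simp [kalmanMatrix, hB]
  rw [this, rank_zero] at hm
  omega

/-- In the normal coordinates the vertical subspace has a frame `a + i b`, in which both the
control matrix and the endpoint map are expressed. -/
theorem HasNormalForm.exists_frame {ω : Fin n → ℝ} (hω : L.HasNormalForm ω) :
    ∃ a b : Matrix (Fin n) (Fin n) ℝ, aᵀ * b = bᵀ * a ∧ (aᵀ * a + bᵀ * b).PosDef ∧
      L.B * L.Bᵀ = aᵀ * diagonal ω * a + bᵀ * diagonal ω * b ∧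
      ∀ t : ℝ, L.endpointMatrix t = ((ofReIm a b)ᴴ *
        diagonal (fun j => Complex.exp ((-(t * ω j) : ℝ) * Complex.I)) *
          ofReIm a b).map Complex.im := by
  obtain ⟨M, hM, hH⟩ := hω
  set P := M.toBlocks₁₁
  set S := M.toBlocks₁₂
  set R := M.toBlocks₂₁
  set T := M.toBlocks₂₂
  have hMb : M = fromBlocks P S R T := (fromBlocks_toBlocks M).symm
  -- the inverse of a symplectic matrix
  set N : Matrix (Fin n ⊕ Fin n) (Fin n ⊕ Fin n) ℝ := fromBlocks Tᵀ (-Sᵀ) (-Rᵀ) Pᵀ with hN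
  have hNM : N * M = 1 := by
    have h := hM
    rw [IsSymplectic, symplecticForm, hMb, fromBlocks_transpose, fromBlocks_multiply,
      fromBlocks_multiply, fromBlocks_inj] at h
    obtain ⟨h1, h2, h3, h4⟩ := h
    simp only [mul_zero, mul_one, mul_neg, zero_add, add_zero, neg_mul] at h1 h2 h3 h4
    rw [hN, hMb, fromBlocks_multiply, ← fromBlocks_one, fromBlocks_inj]
    simp only [neg_mul]
    refine ⟨?_, ?_, ?_, ?_⟩
    · rw [← neg_inj, ← h3]; abel
    · rw [← neg_zero, ← h4]; abel
    · rw [← h1, neg_add_eq_sub, sub_eq_add_neg]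
    · rw [← h2, neg_add_eq_sub, sub_eq_add_neg]
  have hMN : M * N = 1 := mul_eq_one_comm.1 hNM
  have hinv : M⁻¹ = N := inv_eq_right_inv hMN
  set H₀ : Matrix (Fin n ⊕ Fin n) (Fin n ⊕ Fin n) ℝ := fromBlocks (diagonal ω) 0 0 (diagonal ω)
    with hH₀
  have hLsymm : L.hamiltonianMatrix.IsSymm := by
    rw [IsSymm, hamiltonianMatrix, fromBlocks_transpose, L.Q_symm.eq]
    simp
  have hMHM : Mᵀ * L.hamiltonianMatrix * M = H₀ := by
    rw [← sub_eq_zero]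
    refine IsSymm.eq_zero_of_forall_dotProduct ?_ fun z => ?_
    · rw [IsSymm, transpose_sub, transpose_mul, transpose_mul, hLsymm.eq, transpose_transpose,
        hH₀, fromBlocks_transpose, mul_assoc]
      simp
    · have h1 := hH z
      rw [hamiltonian] at h1
      have h2 : z ⬝ᵥ H₀ *ᵥ z = ∑ j, ω j * (z (Sum.inl j) ^ 2 + z (Sum.inr j) ^ 2) := by
        rw [hH₀, fromBlocks_mulVec, dotProduct, Fintype.sum_sum_type, ← Finset.sum_add_distrib]
        refine Finset.sum_congr rfl fun j _ => ?_
        simp [mulVec_diagonal]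
        ring
      have h3 : z ⬝ᵥ (Mᵀ * L.hamiltonianMatrix * M) *ᵥ z =
          (M *ᵥ z) ⬝ᵥ L.hamiltonianMatrix *ᵥ (M *ᵥ z) := by
        rw [← mulVec_mulVec, ← mulVec_mulVec, dotProduct_mulVec, vecMul_transpose]
      rw [sub_mulVec, dotProduct_sub, h2, h3]
      linarith
  have hHN : L.hamiltonianMatrix = Nᵀ * H₀ * N := by
    rw [← hMHM]
    have hNMt : Nᵀ * Mᵀ = 1 := by rw [← transpose_mul, hMN, transpose_one]
    calc L.hamiltonianMatrix = (Nᵀ * Mᵀ) * L.hamiltonianMatrix * (M * N) := by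
          rw [hNMt, hMN, one_mul, mul_one]
      _ = _ := by simp only [mul_assoc]
  have hΩN : symplecticForm n * Nᵀ = M * symplecticForm n := by
    rw [hN, symplecticForm, fromBlocks_transpose, hMb, fromBlocks_multiply, fromBlocks_multiply]
    simp
  have hexp : ∀ t : ℝ, NormedSpace.exp (t • (symplecticForm n * L.hamiltonianMatrix)) =
      M * realification n (diagonal fun j => Complex.exp ((-(t * ω j) : ℝ) * Complex.I)) * N := by
    intro t
    have h1 : t • (symplecticForm n * L.hamiltonianMatrix) =
        M * realification n (diagonal fun j => ((-(t * ω j) : ℝ) : ℂ) * Complex.I) * M⁻¹ := by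
      have h2 : realification n (diagonal fun j => ((-(t * ω j) : ℝ) : ℂ) * Complex.I) =
          t • (symplecticForm n * H₀) := by
        rw [symplecticForm, hH₀, fromBlocks_multiply, fromBlocks_smul]
        change fromBlocks _ _ _ _ = _
        rw [fromBlocks_inj]
        refine ⟨?_, ?_, ?_, ?_⟩ <;> ext i j <;> by_cases h : i = j <;> simp [h, diagonal]
      rw [hinv, h2, hHN, ← mul_assoc, ← mul_assoc, hΩN]
      simp only [mul_assoc, mul_smul_comm, smul_mul_assoc]
    have hu : IsUnit M := IsUnit.of_mul_eq_one N hMN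
    rw [h1, exp_conj _ _ hu, hinv, ← realification_exp, exp_diagonal]
    congr 4
    ext j
    rw [Pi.coe_exp, Complex.exp_eq_exp_ℂ]
  -- The first block column of `M⁻¹` maps `p` to the normal coordinates of `(p, 0)`.
  refine ⟨Tᵀ, -Rᵀ, ?_, ?_, ?_, fun t => ?_⟩
  · have h := hMN
    rw [hMb, hN, fromBlocks_multiply, ← fromBlocks_one, fromBlocks_inj] at h
    have := h.2.2.1
    rw [mul_neg, ← sub_eq_add_neg, sub_eq_zero] at this
    simp [this]
  · refine PosDef.of_dotProduct_mulVec_pos ?_ fun x hx => ?_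
    · rw [IsHermitian, conjTranspose_eq_transpose_of_trivial]
      simp
    · have hsq : ∀ A : Matrix (Fin n) (Fin n) ℝ, x ⬝ᵥ (Aᵀ * A) *ᵥ x = (A *ᵥ x) ⬝ᵥ (A *ᵥ x) := by
        intro A
        rw [← mulVec_mulVec, dotProduct_mulVec, vecMul_transpose]
      have hnn : ∀ y : Fin n → ℝ, 0 ≤ y ⬝ᵥ y := fun y =>
        Finset.sum_nonneg fun i _ => mul_self_nonneg _
      rw [star_trivial, add_mulVec, dotProduct_add, hsq, hsq]
      refine lt_of_le_of_ne (add_nonneg (hnn _) (hnn _)) fun h0 => hx ?_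
      have h1 : Tᵀ *ᵥ x = 0 := dotProduct_self_eq_zero.1
        (by linarith [hnn (Tᵀ *ᵥ x), hnn (-Rᵀ *ᵥ x)])
      have h2 : -Rᵀ *ᵥ x = 0 := dotProduct_self_eq_zero.1
        (by linarith [hnn (Tᵀ *ᵥ x), hnn (-Rᵀ *ᵥ x)])
      have h3 : N *ᵥ Sum.elim x 0 = 0 := by
        rw [hN, fromBlocks_mulVec, Sum.elim_comp_inl, Sum.elim_comp_inr, h1, h2]
        ext (i | i) <;> simp
      have h4 : (Sum.elim x 0 : PhaseSpace n) = 0 := by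
        rw [← one_mulVec (Sum.elim x 0 : PhaseSpace n), ← hMN, ← mulVec_mulVec, h3, mulVec_zero]
      ext i
      exact congrFun h4 (Sum.inl i)
  · have h := hHN
    rw [hN, hH₀, hamiltonianMatrix, fromBlocks_transpose, fromBlocks_multiply, fromBlocks_multiply,
      fromBlocks_inj] at h
    rw [h.1]
    simp
  · rw [endpointMatrix, hexp t]
    set D := diagonal fun j => Complex.exp ((-(t * ω j) : ℝ) * Complex.I)
    rw [hMb, hN]
    change (fromBlocks P S R T * fromBlocks (D.map Complex.re) (-D.map Complex.im)
      (D.map Complex.im) (D.map Complex.re) * fromBlocks Tᵀ (-Sᵀ) (-Rᵀ) Pᵀ).toBlocks₂₁ = _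
    rw [fromBlocks_multiply, fromBlocks_multiply, toBlocks_fromBlocks₂₁]
    simp only [map_im_mul, map_re_mul, map_re_ofReIm, map_im_ofReIm, map_re_conjTranspose_ofReIm,
      map_im_conjTranspose_ofReIm, transpose_transpose, transpose_neg]
    simp
    noncomm_ring

end LQProblem

/-! ### Conjugate times -/

namespace LQProblem

variable {n k : ℕ} {L : LQProblem n k} {ω : Fin n → ℝ}

theorem HasNormalForm.sum_pos (hn : 0 < n) (hL : L.IsControllable) (hω : L.HasNormalForm ω) :
    0 < ∑ j, ω j := by
  obtain ⟨a, b, hab, hG, hB, -⟩ := hω.exists_frame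
  rw [sum_eq_trace_gram_inv hab ((isUnit_iff_isUnit_det _).1 hG.isUnit), ← hB]
  exact trace_mul_mul_transpose_pos hG.inv (hL.ne_zero hn)

/-- The estimate of the total multiplicity includes `t = 0`, where the multiplicity is `n`. -/
theorem HasNormalForm.lt_sum_multiplicity (hn : 0 < n) (hω : L.HasNormalForm ω) {T : ℝ}
    (hT : 0 ≤ T) (Z : Finset ℝ) (hZ : ∀ t ∈ Set.Icc 0 T, L.multiplicity t ≠ 0 → t ∈ Z) :
    T * (∑ j, ω j) / Real.pi - n < ∑ t ∈ Z, (L.multiplicity t : ℝ) := by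
  obtain ⟨a, b, hab, hG, -, hE⟩ := hω.exists_frame
  have hdetZ : (ofReIm a b).det ≠ 0 := by
    intro h
    have h1 := congrArg det (gram_ofReIm hab)
    have h2 : (aᵀ * a + bᵀ * b).toComplex.det = ((aᵀ * a + bᵀ * b).det : ℂ) :=
      (Complex.ofRealHom.map_det _).symm
    rw [det_mul, h, mul_zero, h2] at h1
    exact ((isUnit_iff_isUnit_det _).1 hG.isUnit).ne_zero (by exact_mod_cast h1.symm)
  obtain ⟨W, hW, hrank⟩ := exists_souriau hab hdetZ
  have hW' : W * star W = 1 := mul_eq_one_comm.1 hW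
  set D : ℝ → Matrix (Fin n) (Fin n) ℂ := fun t =>
    diagonal fun j => Complex.exp ((-(t * ω j) : ℝ) * Complex.I) with hD
  have hDD : ∀ t, star (D t) * D t = 1 := by
    intro t
    rw [star_eq_conjTranspose, hD, diagonal_conjTranspose, diagonal_mul_diagonal, ← diagonal_one]
    congr 1
    ext j
    rw [Pi.star_apply, RCLike.star_def, Complex.conj_mul', Complex.norm_exp_ofReal_mul_I]
    simp
  have hDc : Continuous D := by
    refine Continuous.matrix_diagonal (continuous_pi fun j => ?_)
    fun_prop
  -- The sign moves the eigenvalue `1` of the Souriau map to `-1`, the cut of the argument.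
  set U : ℝ → Matrix (Fin n) (Fin n) ℂ := fun t => -(D t * star W * D t * W) with hU
  have hr : ∀ t, (L.endpointMatrix t).rank ≤ (U t + 1).rank := by
    intro t
    have h1 : (U t + 1) = 1 - D t * star W * D t * W := by rw [hU, neg_add_eq_sub]
    rw [h1, ← hrank (D t) (diagonal_transpose _) (hDD t), ← hE t]
    exact rank_le_rank_toComplex _
  have hrn : ∀ t, (U t + 1).rank ≤ n := fun t => by
    simpa using (U t + 1).rank_le_card_width
  have hmult := L.multiplicity_eq
  refine (lt_sum_corank hn (U := U) (σ := ∑ j, ω j) (c := (-1) ^ n) ?_ ?_ ?_ hT Z ?_).trans_le ?_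
  · exact (((hDc.mul continuous_const).mul hDc).mul continuous_const).neg
  · intro t
    have hsw : star (star W) = W := star_star W
    rw [hU, star_neg, neg_mul_neg, star_mul, star_mul, star_mul, hsw]
    calc star W * (star (D t) * (W * star (D t))) * (D t * star W * D t * W)
        = star W * (star (D t) * (W * (star (D t) * D t) * star W) * D t) * W := by
          simp only [mul_assoc]
      _ = 1 := by rw [hDD, mul_one, hW', mul_one, hDD, mul_one, hW]
  · intro t
    have hdetD : (D t).det = Complex.exp ((-(t * ∑ j, ω j) : ℝ) * Complex.I) := by
      rw [hD, det_diagonal, ← Complex.exp_sum, ← Finset.sum_mul, ← Complex.ofReal_sum,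
        Finset.sum_neg_distrib, Finset.mul_sum]
    have hdetW : (star W).det * W.det = 1 := by rw [← det_mul, hW, det_one]
    rw [hU, det_neg, Fintype.card_fin, det_mul, det_mul, det_mul, hdetD]
    congr 1
    calc _ = (Complex.exp ((-(t * ∑ j, ω j) : ℝ) * Complex.I) *
          Complex.exp ((-(t * ∑ j, ω j) : ℝ) * Complex.I)) * ((star W).det * W.det) := by ring
      _ = _ := by
        rw [hdetW, mul_one, ← Complex.exp_add]
        congr 1
        push_cast
        ring
  · intro t ht h
    refine hZ t ht ?_
    have := hr t
    have := hrn t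
    have := hmult t
    omega
  · refine Finset.sum_le_sum fun t _ => ?_
    have h1 := hr t
    have h2 := hrn t
    have h3 : n ≤ L.multiplicity t + (U t + 1).rank := by
      have := hmult t
      omega
    have : (n : ℝ) ≤ L.multiplicity t + (U t + 1).rank := by exact_mod_cast h3
    linarith

/-- Discarding the multiplicity of `t = 0` costs at most `n`. -/
theorem HasNormalForm.le_conjugateCount (hn : 0 < n) (hω : L.HasNormalForm ω) {T : ℝ}
    (hT : 0 ≤ T) {N : ℕ} (hN : N + 2 * n - 1 ≤ T * (∑ j, ω j) / Real.pi) :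
    (N : ℕ∞) ≤ L.conjugateCount T := by
  have hcount : ∀ s : Finset ℝ, (∀ t ∈ s, 0 < t ∧ t ≤ T ∧ L.IsConjugateTime t) →
      N ≤ ∑ t ∈ s, L.multiplicity t → (N : ℕ∞) ≤ L.conjugateCount T := by
    intro s hs hle
    refine le_trans ?_ (le_iSup₂ (f := fun (s : Finset ℝ)
      (_ : ∀ t ∈ s, 0 < t ∧ t ≤ T ∧ L.IsConjugateTime t) =>
        ((∑ t ∈ s, L.multiplicity t : ℕ) : ℕ∞)) s hs)
    exact_mod_cast hle
  by_cases hfin : {t | 0 < t ∧ t ≤ T ∧ L.IsConjugateTime t}.Finite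
  · refine hcount hfin.toFinset (fun t ht => hfin.mem_toFinset.1 ht) ?_
    have h0 : (0 : ℝ) ∉ hfin.toFinset := fun h => lt_irrefl _ (hfin.mem_toFinset.1 h).1
    have h := hω.lt_sum_multiplicity hn hT (insert 0 hfin.toFinset) fun t ht hm => by
      rcases ht.1.eq_or_lt with rfl | hpos
      · exact Finset.mem_insert_self _ _
      · exact Finset.mem_insert_of_mem
          (hfin.mem_toFinset.2 ⟨hpos, ht.2, isConjugateTime_iff.2 hm⟩)
    rw [Finset.sum_insert h0] at h
    have hmn : (L.multiplicity 0 : ℝ) ≤ n := by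
      rw [L.multiplicity_eq]
      exact_mod_cast Nat.sub_le _ _
    have h' : (N : ℝ) < (∑ t ∈ hfin.toFinset, L.multiplicity t : ℕ) + 1 := by
      push_cast
      linarith
    exact Nat.lt_succ_iff.1 (by exact_mod_cast h')
  · obtain ⟨s, hs, hcard⟩ := Set.Infinite.exists_subset_card_eq hfin N
    refine hcount s (fun t ht => hs ht) ?_
    rw [← hcard, Finset.card_eq_sum_ones]
    exact Finset.sum_le_sum fun t ht =>
      Nat.one_le_iff_ne_zero.2 (isConjugateTime_iff.1 (hs ht).2.2)

end LQProblem

theorem corollaryc {n k : ℕ} (hn : 0 < n) (L : LQProblem n k) (hL : L.IsControllable)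
    (ω : Fin n → ℝ) (hω : L.HasNormalForm ω) :
    0 < ∑ j, ω j ∧
    (∀ (N : ℕ) (T : ℝ), ((N : ℝ) + 3 * (n : ℝ) - 1) * Real.pi / (∑ j, ω j) ≤ T →
      (N : ℕ∞) ≤ L.conjugateCount T) ∧
    (L.positiveConjugateTimes.Nonempty ∧
      L.firstConjugateTime ≤ 3 * (n : ℝ) * Real.pi / (∑ j, ω j)) := by
  have hσ := hω.sum_pos hn hL
  have hn1 : (1 : ℝ) ≤ n := by exact_mod_cast hn
  have hcount : ∀ (N : ℕ) (T : ℝ), ((N : ℝ) + 3 * (n : ℝ) - 1) * Real.pi / (∑ j, ω j) ≤ T →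
      (N : ℕ∞) ≤ L.conjugateCount T := by
    intro N T hT
    have hN : (0 : ℝ) ≤ N := N.cast_nonneg
    refine hω.le_conjugateCount hn (le_trans ?_ hT) ?_
    · have : (0 : ℝ) ≤ N + 3 * n - 1 := by linarith
      have := Real.pi_pos
      positivity
    · rw [div_le_iff₀ hσ] at hT
      rw [le_div_iff₀ Real.pi_pos]
      nlinarith [Real.pi_pos]
  refine ⟨hσ, hcount, ?_⟩
  obtain ⟨t, ht, htT⟩ : ∃ t ∈ L.positiveConjugateTimes, t ≤ 3 * n * Real.pi / ∑ j, ω j := by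
    by_contra! hcon
    have h1 := hcount 1 (3 * n * Real.pi / ∑ j, ω j) (le_of_eq (by push_cast; ring))
    have h0 : L.conjugateCount (3 * n * Real.pi / ∑ j, ω j) ≤ 0 := by
      refine iSup₂_le fun s hs => ?_
      rcases s.eq_empty_or_nonempty with rfl | ⟨t, ht⟩
      · simp
      · obtain ⟨hpos, hle, hc⟩ := hs t ht
        exact absurd hle (hcon t ⟨hpos, hc⟩).not_ge
    exact absurd (h1.trans h0) (by simp)
  exact ⟨⟨t, ht⟩, (csInf_le ⟨0, fun s hs => hs.1.le⟩ ht).trans htT⟩
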